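/- Let $R$ be an associative, possibly nonunital ring, and let $\widetilde R=\mathbb Z\oplus R$ be the unital ring obtained by formally adjoining a unit. Nonunital left $R$-modules are the same as unital left $\widetilde R$-modules; let $R\text{-}\mathsf{Mod}^{n}$ be their abelian category, and write $\operatorname{Hom}_R$ and $\otimes_R$ for Hom and tensor product of nonunital $R$-modules. A left $R$-module $M$ is called *t-unital* if the natural map $R\otimes_R M\to M$, $r\otimes m\mapsto rm$, is an isomorphism, and the ring $R$ is called *t-unital* if the natural map $R\otimes_R R\to R$ is an isomorphism. A left $R$-module $P$ is called *c-unital* if the natural map $P\to\operatorname{Hom}_R(R,P)$, $p\mapsto(r\mapsto rp)$, is an isomorphism. Let $R\text{-}\mathsf{Mod}^{t}$ and $R\text{-}\mathsf{Mod}^{c}$ denote the full subcategories of t-unital and of c-unital modules in $R\text{-}\mathsf{Mod}^{n}$. A nonunital left $R$-module $Q$ is called *c-projective* if the functor $\operatorname{Hom}_R(Q,-)\colon R\text{-}\mathsf{Mod}^{c}\to\mathsf{Ab}$ takes cokernels in the category $R\text{-}\mathsf{Mod}^{c}$ to cokernels in $\mathsf{Ab}$. A nonunital left $R$-module $J$ is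 called *t-injective* if the contravariant functor $\operatorname{Hom}_R(-,J)\colon (R\text{-}\mathsf{Mod}^{t})^{\mathrm{op}}\to\mathsf{Ab}$ takes kernels in the category $R\text{-}\mathsf{Mod}^{t}$ to cokernels in $\mathsf{Ab}$. Assume that the ring $R$ is t-unital. Then: 1. a t-unital left $R$-module $Q$ is c-projective if and only if it is projective as an object of $R\text{-}\mathsf{Mod}^{n}$ (that is, as a unital $\widetilde R$-module); 2. a c-unital left $R$-module $J$ is t-injective if and only if it is injective as an object of $R\text{-}\mathsf{Mod}^{n}$ (that is, as a unital $\widetilde R$-module). -/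

import Mathlib

open CategoryTheory CategoryTheory.Limits Opposite
open scoped TensorProduct

universe u

namespace NonunitalMod

/-- The unitalization `ℤ ⊕ R` of an associative, possibly nonunital ring `R`: its elements are the
formal sums `n + r`, and `R` is a two-sided ideal in it. -/
def Unitalization (R : Type u) [NonUnitalRing R] : Type u := Unitization ℤ R

instance instRingUnitalization (R : Type u) [NonUnitalRing R] : Ring (Unitalization R) :=
  inferInstanceAs (Ring (Unitization ℤ R))

/-- The inclusion of `R` into its unitalization as a two-sided ideal. -/
def incl {R : Type u} [NonUnitalRing R] (r : R) : Unitalization R :=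
  (Unitization.inr r : Unitization ℤ R)

section Inclusion

variable {R : Type u} [NonUnitalRing R]

theorem incl_zero : incl (0 : R) = 0 := Unitization.inr_zero ℤ

theorem incl_add (r s : R) : incl (r + s) = incl r + incl s := Unitization.inr_add ℤ r s

theorem incl_mul (r s : R) : incl (r * s) = incl r * incl s := Unitization.inr_mul ℤ r s

/-- The inclusion as an additive map. -/
def inclHom (R : Type u) [NonUnitalRing R] : R →+ Unitalization R where
  toFun := incl
  map_zero' := incl_zero
  map_add' := incl_add

theorem incl_zsmul (n : ℤ) (r : R) : incl (n • r) = n • incl r := map_zsmul (inclHom R) n r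

end Inclusion

/-- The abelian category of nonunital left `R`-modules, that is, of unital left modules over the
unitalization `ℤ ⊕ R`. The action of `r : R` is the action of `incl r`. -/
abbrev NMod (R : Type u) [NonUnitalRing R] : Type (u + 1) := ModuleCat.{u} (Unitalization R)

section Elementwise

variable (R : Type u) [NonUnitalRing R]

/-- The ring `R` as a nonunital left module over itself: `(n + r) • s = n • s + r * s`. -/
instance instModuleSelf : Module (Unitalization R) R where
  smul := fun (x : Unitization ℤ R) s => x.fst • s + x.snd * s
  one_smul s := by
    change (1 : Unitization ℤ R).fst • s + (1 : Unitization ℤ R).snd * s = s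
    simp
  mul_smul (x y : Unitization ℤ R) s := by
    change (x * y).fst • s + (x * y).snd * s
      = x.fst • (y.fst • s + y.snd * s) + x.snd * (y.fst • s + y.snd * s)
    simp only [Unitization.fst_mul, Unitization.snd_mul, add_mul, mul_add, smul_add, mul_smul,
      smul_mul_assoc, mul_smul_comm, mul_assoc]
    abel
  smul_zero (x : Unitization ℤ R) := by
    change x.fst • (0 : R) + x.snd * 0 = 0
    simp
  zero_smul s := by
    change (0 : Unitization ℤ R).fst • s + (0 : Unitization ℤ R).snd * s = 0
    simp
  smul_add (x : Unitization ℤ R) s t := by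
    change x.fst • (s + t) + x.snd * (s + t) = (x.fst • s + x.snd * s) + (x.fst • t + x.snd * t)
    rw [smul_add, mul_add]
    abel
  add_smul (x y : Unitization ℤ R) s := by
    change (x + y).fst • s + (x + y).snd * s = (x.fst • s + x.snd * s) + (y.fst • s + y.snd * s)
    rw [Unitization.fst_add, Unitization.snd_add, add_smul, add_mul]
    abel

theorem incl_smul_self (r s : R) : incl r • s = r * s := by
  change (Unitization.inr r : Unitization ℤ R).fst • s
    + (Unitization.inr r : Unitization ℤ R).snd * s = r * s
  simp

theorem incl_smul (x : Unitalization R) (r : R) : incl (x • r) = x * incl r := by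
  have key : ∀ y : Unitization ℤ R,
      (Unitization.inr (y.fst • r + y.snd * r) : Unitization ℤ R) = y * Unitization.inr r := by
    intro y
    refine Unitization.ext ?_ ?_
    · simp only [Unitization.fst_inr, Unitization.fst_mul, mul_zero]
    · simp only [Unitization.fst_inr, Unitization.snd_inr, Unitization.snd_mul, zero_smul, add_zero]
  exact key x

variable (M : Type u) [AddCommGroup M] [Module (Unitalization R) M]

/-- The subgroup of `R ⊗_ℤ M` generated by the elements `r s ⊗ m - r ⊗ s m`. -/
def tensorRel : AddSubgroup (R ⊗[ℤ] M) :=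
  AddSubgroup.closure
    {x | ∃ (r s : R) (m : M),
      x = (r * s) ⊗ₜ[ℤ] m - r ⊗ₜ[ℤ] (incl s • m)}

/-- The tensor product `R ⊗_R M` of the right `R`-module `R` with a nonunital left
`R`-module `M`, as an abelian group. -/
abbrev RTensor : Type u := (R ⊗[ℤ] M) ⧸ tensorRel R M

/-- The additive map `R ⊗_ℤ M → M`, `r ⊗ m ↦ r m`. -/
noncomputable def preMulMap : R ⊗[ℤ] M →+ M :=
  TensorProduct.liftAddHom
    { toFun := fun r =>
        { toFun := fun m => incl r • m
          map_zero' := smul_zero _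
          map_add' := smul_add _ }
      map_zero' := by
        ext m
        change incl (0 : R) • m = 0
        rw [incl_zero, zero_smul]
      map_add' := fun r s => by
        ext m
        change incl (r + s) • m = incl r • m + incl s • m
        rw [incl_add, add_smul] }
    (fun n r m => by
      change incl (n • r) • m = incl r • (n • m)
      rw [incl_zsmul, smul_assoc, smul_comm])

theorem preMulMap_tmul (r : R) (m : M) :
    preMulMap R M (r ⊗ₜ[ℤ] m) = incl r • m := rfl

theorem tensorRel_le_ker : tensorRel R M ≤ (preMulMap R M).ker := by
  refine (AddSubgroup.closure_le _).2 ?_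
  rintro x ⟨r, s, m, rfl⟩
  simp only [SetLike.mem_coe, AddMonoidHom.mem_ker, map_sub, preMulMap_tmul, incl_mul,
    mul_smul, sub_self]

/-- The natural map `R ⊗_R M → M`, `r ⊗ m ↦ r m`. -/
noncomputable def mulMap : RTensor R M →+ M :=
  QuotientAddGroup.lift (tensorRel R M) (preMulMap R M) (tensorRel_le_ker R M)

/-- A nonunital left `R`-module `M` is t-unital if the natural map `R ⊗_R M → M` is an
isomorphism. -/
def IsTUnital : Prop := Function.Bijective (mulMap R M)

/-- A ring `R` is t-unital if the natural map `R ⊗_R R → R` is an isomorphism. -/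
def IsTUnitalRing : Prop := IsTUnital R R

/-- The natural map `P → Hom_R(R, P)`, `p ↦ (r ↦ r p)`. -/
def homMap : M →+ (R →ₗ[Unitalization R] M) where
  toFun p :=
    { toFun := fun r => incl r • p
      map_add' := fun r s => by rw [incl_add, add_smul]
      map_smul' := fun x r => by
        rw [RingHom.id_apply, ← mul_smul, incl_smul] }
  map_zero' := by ext r; exact smul_zero _
  map_add' p q := by ext r; exact smul_add _ _ _

/-- A nonunital left `R`-module `P` is c-unital if the natural map `P → Hom_R(R, P)` is an
isomorphism. -/
def IsCUnital : Prop := Function.Bijective (homMap R M)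

end Elementwise

section Categories

variable (R : Type u) [NonUnitalRing R]

/-- The full subcategory of t-unital modules in the category of nonunital left `R`-modules. -/
abbrev TMod : Type (u + 1) := ObjectProperty.FullSubcategory (fun M : NMod R => IsTUnital R M)

/-- The full subcategory of c-unital modules in the category of nonunital left `R`-modules. -/
abbrev CMod : Type (u + 1) := ObjectProperty.FullSubcategory (fun P : NMod R => IsCUnital R P)

variable {R}

/-- The covariant functor `Hom_R(Q, -)` from c-unital modules to abelian groups. -/
noncomputable abbrev homFromFunctor (Q : NMod R) : CMod R ⥤ AddCommGrpCat.{u} :=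
  ObjectProperty.ι (fun P : NMod R => IsCUnital R P) ⋙ preadditiveCoyoneda.obj (op Q)

/-- The contravariant functor `Hom_R(-, J)` from t-unital modules to abelian groups. -/
noncomputable abbrev homToFunctor (J : NMod R) : (TMod R)ᵒᵖ ⥤ AddCommGrpCat.{u} :=
  (ObjectProperty.ι (fun M : NMod R => IsTUnital R M)).op ⋙ preadditiveYoneda.obj J

/-- `Q` (not necessarily c-unital) is c-projective if the functor `Hom_R(Q, -)` takes cokernels in
the category of c-unital modules to cokernels of abelian groups. -/
def IsCProjective (Q : NMod R) : Prop :=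
  ∀ ⦃L M : CMod R⦄ (f : L ⟶ M), PreservesColimit (parallelPair f 0) (homFromFunctor Q)

/-- `J` (not necessarily t-unital) is t-injective if the functor `Hom_R(-, J)` takes kernels in
the category of t-unital modules, which are the cokernels in the opposite category, to cokernels
of abelian groups. -/
def IsTInjective (J : NMod R) : Prop :=
  ∀ ⦃L M : TMod R⦄ (f : L ⟶ M), PreservesColimit (parallelPair f.op 0) (homToFunctor J)

end Categories

end NonunitalMod

/-! Since `R` is t-unital, `Hom_R(R, -)` lands in the c-unital modules and is a reflector onto them,
while `R ⊗_R -` lands in the t-unital modules and is a coreflector (`isCUnital_hom`,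
`isTUnital_tensor`, `homAdjunction`, `tensorAdjunction`). For t-unital `Q`, the functor `Hom_R(Q,
-)` inverts every reflection map `M → Hom_R(R, M)` (`bijective_homMapLinear_comp`), so it factors
through the reflector. Cokernels of c-unital modules are the reflections of cokernels of all
modules; hence preserving the former is the same as preserving the latter
(`preservesCokernels_comp_iff_of_isIso_map_unit`). As `Hom_R(Q, -)` is left exact, this means that
it preserves epimorphisms, i.e. that `Q` is projective. Statement 2 is the same argument in the
opposite category, with `bijective_comp_mulMapLinear` for c-unital `J`. -/

namespace NonunitalMod

/-! ### Cokernels in reflective subcategories -/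

section Reflection

universe v v₁ u₁ v₂ u₂ v₃ u₃

/-- A functor preserving zero morphisms commutes with the formation of the diagram whose colimit
is a cokernel. -/
def parallelPairZeroCompIso {C : Type u₁} [Category.{v₁} C] {D : Type u₂} [Category.{v₂} D]
    [HasZeroMorphisms C] [HasZeroMorphisms D] {X Y : C} (f : X ⟶ Y) (F : C ⥤ D)
    [F.PreservesZeroMorphisms] : parallelPair f 0 ⋙ F ≅ parallelPair (F.map f) 0 :=
  diagramIsoParallelPair _ ≪≫
    parallelPair.ext (Iso.refl _) (Iso.refl _) (by simp) (by simp)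

/-- If `F` inverts the reflections onto a reflective subcategory `D` of `C`, then `F` preserves
cokernels in `C` if and only if its restriction to `D` preserves cokernels in `D`. -/
theorem preservesCokernels_comp_iff_of_isIso_map_unit {C : Type u₁} [Category.{v₁} C]
    {D : Type u₂} [Category.{v₂} D] {E : Type u₃} [Category.{v₃} E]
    [HasZeroMorphisms C] [HasZeroMorphisms D] [HasCokernels C]
    {G : C ⥤ D} {i : D ⥤ C} (adj : G ⊣ i) [i.Full] [i.Faithful]
    [i.PreservesZeroMorphisms] [G.PreservesZeroMorphisms] (F : C ⥤ E)
    (hF : ∀ X, IsIso (F.map (adj.unit.app X))) :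
    (∀ ⦃X Y : D⦄ (f : X ⟶ Y), PreservesColimit (parallelPair f 0) (i ⋙ F)) ↔
      ∀ ⦃X Y : C⦄ (f : X ⟶ Y), PreservesColimit (parallelPair f 0) F := by
  have : IsIso (Functor.whiskerRight adj.unit F) := by
    have : ∀ X, IsIso ((Functor.whiskerRight adj.unit F).app X) := hF
    exact NatIso.isIso_of_isIso_app _
  let e : F ≅ G ⋙ i ⋙ F := asIso (Functor.whiskerRight adj.unit F)
  have := adj.leftAdjoint_preservesColimits
  refine ⟨fun h X Y f ↦ ?_, fun h X Y f ↦ ?_⟩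
  -- `G` is a left adjoint, so it preserves the cokernel of `f`, and `i ⋙ F` preserves that of
  -- `G.map f`; the composite is `F` up to isomorphism.
  · have := h (G.map f)
    have : PreservesColimit (parallelPair f 0 ⋙ G) (i ⋙ F) :=
      preservesColimit_of_iso_diagram _ (parallelPairZeroCompIso f G).symm
    exact preservesColimit_of_natIso _ e.symm
  · have := h (i.map f)
    have : PreservesColimit (parallelPair (i.map f) 0) (G ⋙ i ⋙ F) :=
      preservesColimit_of_natIso _ e
    -- Both `G` and `G ⋙ i ⋙ F` send this cokernel cocone to a colimit, so `i ⋙ F` preserves one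
    -- colimit of the reflected diagram, hence all. The counit identifies that diagram with the one
    -- of `f`.
    have hc := colimit.isColimit (parallelPair (i.map f) 0)
    have : PreservesColimit (parallelPair (i.map f) 0 ⋙ G) (i ⋙ F) :=
      preservesColimit_of_preserves_colimit_cocone (isColimitOfPreserves G hc)
        (isColimitOfPreserves (G ⋙ i ⋙ F) hc)
    exact preservesColimit_of_iso_diagram _
      (Functor.isoWhiskerRight (parallelPairZeroCompIso f i).symm G ≪≫
        Functor.isoWhiskerLeft (parallelPair f 0) (asIso adj.counit) ≪≫ Functor.rightUnitor _)

/-- A left exact functor preserves cokernels if and only if it preserves epimorphisms. -/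
theorem preservesCokernels_iff_preservesEpimorphisms {C : Type u₁} [Category.{v₁} C] [Abelian C]
    {E : Type u₃} [Category.{v₃} E] [Abelian E] (F : C ⥤ E) [F.Additive]
    [PreservesFiniteLimits F] :
    (∀ ⦃X Y : C⦄ (f : X ⟶ Y), PreservesColimit (parallelPair f 0) F) ↔
      F.PreservesEpimorphisms := by
  refine ⟨fun h ↦ ?_, fun h X Y f ↦ ?_⟩
  · have : ∀ {X Y : C} (f : X ⟶ Y), PreservesColimit (parallelPair f 0) F := fun f ↦ h f
    have := F.preservesFiniteColimits_of_preservesCokernels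
    infer_instance
  · have := Functor.preservesHomology_of_preservesEpis_and_kernels F
    exact Functor.PreservesHomology.preservesCokernel F f

theorem preservesCokernels_preadditiveCoyoneda_iff {C : Type u₁} [Category.{v₁} C] [Abelian C]
    (Q : C) :
    (∀ ⦃X Y : C⦄ (f : X ⟶ Y),
      PreservesColimit (parallelPair f 0) (preadditiveCoyoneda.obj (op Q))) ↔ Projective Q :=
  (preservesCokernels_iff_preservesEpimorphisms _).trans
    (Projective.projective_iff_preservesEpimorphisms_preadditiveCoyoneda_obj Q).symm

theorem preservesCokernels_preadditiveYoneda_iff {C : Type u₁} [Category.{v₁} C] [Abelian C]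
    (J : C) :
    (∀ ⦃X Y : Cᵒᵖ⦄ (f : X ⟶ Y),
      PreservesColimit (parallelPair f 0) (preadditiveYoneda.obj J)) ↔ Injective J :=
  (preservesCokernels_iff_preservesEpimorphisms _).trans
    (Injective.injective_iff_preservesEpimorphisms_preadditiveYoneda_obj J).symm

end Reflection

/-! ### Module structures on `Hom_R(R, M)` and `R ⊗_R M` -/

section Modules

variable {R : Type u} [NonUnitalRing R]

theorem incl_injective : Function.Injective (incl : R → Unitalization R) :=
  Unitization.inr_injective

theorem exists_eq_zsmul_one_add_incl (x : Unitalization R) :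
    ∃ (n : ℤ) (r : R), x = n • 1 + incl r := by
  refine ⟨(show Unitization ℤ R from x).fst, (show Unitization ℤ R from x).snd, ?_⟩
  have key : ∀ y : Unitization ℤ R, y = y.fst • 1 + Unitization.inr y.snd := fun y ↦ by
    refine Unitization.ext ?_ ?_
    · simp only [Unitization.fst_add, Unitization.fst_smul, Unitization.fst_one,
        Unitization.fst_inr, smul_eq_mul, mul_one, add_zero]
    · simp only [Unitization.snd_add, Unitization.snd_smul, Unitization.snd_one,
        Unitization.snd_inr, smul_zero, zero_add]
  exact key x

/-- An additive map commuting with the action of `R` is linear over the unitalization. -/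
def linearMapOfIncl {M N : Type*} [AddCommGroup M] [Module (Unitalization R) M] [AddCommGroup N]
    [Module (Unitalization R) N] (f : M →+ N) (hf : ∀ (r : R) m, f (incl r • m) = incl r • f m) :
    M →ₗ[Unitalization R] N where
  __ := f
  map_smul' x m := by
    obtain ⟨n, r, rfl⟩ := exists_eq_zsmul_one_add_incl x
    simp only [add_smul, smul_assoc, one_smul, ZeroHom.toFun_eq_coe, AddMonoidHom.toZeroHom_coe,
      map_add, map_zsmul, hf, RingHom.id_apply]

/-- The right action of the unitalization on `R`, as an action by left linear maps. -/
def rightMul (x : Unitalization R) : R →ₗ[Unitalization R] R :=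
  linearMapOfIncl
    { toFun := fun s ↦ (show Unitization ℤ R from x).fst • s + s * (show Unitization ℤ R from x).snd
      map_zero' := by simp
      map_add' := fun s t ↦ by rw [smul_add, add_mul]; abel }
    (fun r s ↦ by
      simp only [AddMonoidHom.coe_mk, ZeroHom.coe_mk, incl_smul_self, mul_add, mul_assoc,
        mul_smul_comm])

theorem incl_rightMul (x : Unitalization R) (s : R) : incl (rightMul x s) = incl s * x := by
  have key : ∀ y : Unitization ℤ R,
      (Unitization.inr (y.fst • s + s * y.snd) : Unitization ℤ R) = Unitization.inr s * y := by
    intro y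
    refine Unitization.ext ?_ ?_
    · simp only [Unitization.fst_inr, Unitization.fst_mul, zero_mul]
    · simp only [Unitization.snd_inr, Unitization.snd_mul, Unitization.fst_inr, zero_smul, zero_add]
  exact key x

theorem rightMul_incl (r s : R) : rightMul (incl r) s = s * r :=
  incl_injective (by rw [incl_rightMul, incl_mul])

variable (M N : Type u) [AddCommGroup M] [Module (Unitalization R) M] [AddCommGroup N]
  [Module (Unitalization R) N]

/-- The left action on `Hom_R(R, M)` induced by the right action on `R`. -/
instance instModuleHom : Module (Unitalization R) (R →ₗ[Unitalization R] M) where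
  smul x φ := φ ∘ₗ rightMul x
  one_smul φ := LinearMap.ext fun s ↦
    congrArg φ (incl_injective (by rw [incl_rightMul, mul_one]))
  mul_smul x y φ := LinearMap.ext fun s ↦
    congrArg φ (incl_injective (by simp only [incl_rightMul, mul_assoc]))
  smul_zero _ := rfl
  smul_add _ _ _ := rfl
  add_smul x y φ := LinearMap.ext fun s ↦ by
    change φ _ = φ _ + φ _
    rw [← map_add]
    exact congrArg φ (incl_injective (by simp only [incl_rightMul, incl_add, mul_add]))
  zero_smul φ := LinearMap.ext fun s ↦ by
    change φ _ = 0
    rw [← map_zero φ]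
    exact congrArg φ (incl_injective (by simp only [incl_rightMul, incl_zero, mul_zero]))

variable {M N}

theorem incl_smul_hom_apply (r s : R) (φ : R →ₗ[Unitalization R] M) :
    (incl r • φ) s = φ (s * r) :=
  congrArg φ (rightMul_incl r s)

theorem homMap_apply (p : M) (r : R) : homMap R M p r = incl r • p := rfl

variable (R M) in
/-- The natural map `M → Hom_R(R, M)` as a map of modules. -/
def homMapLinear : M →ₗ[Unitalization R] (R →ₗ[Unitalization R] M) :=
  linearMapOfIncl (homMap R M) fun r p ↦ LinearMap.ext fun s ↦ by
    rw [incl_smul_hom_apply, homMap_apply, homMap_apply, incl_mul, mul_smul]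

theorem homMapLinear_apply (p : M) (r : R) : homMapLinear R M p r = incl r • p := rfl

/-- The functoriality of `Hom_R(R, -)`. -/
def homPostcomp (f : M →ₗ[Unitalization R] N) :
    (R →ₗ[Unitalization R] M) →ₗ[Unitalization R] (R →ₗ[Unitalization R] N) where
  toFun φ := f ∘ₗ φ
  map_add' _ _ := LinearMap.ext fun _ ↦ map_add f _ _
  map_smul' _ _ := rfl

section Tensor

variable (M) in
/-- The class of `r ⊗ m` in `R ⊗_R M`. -/
def tmul (r : R) (m : M) : RTensor R M := QuotientAddGroup.mk (r ⊗ₜ[ℤ] m)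

theorem mulMap_tmul (r : R) (m : M) : mulMap R M (tmul M r m) = incl r • m := rfl

theorem tmul_add (r : R) (m m' : M) : tmul M r (m + m') = tmul M r m + tmul M r m' := by
  simp only [tmul, TensorProduct.tmul_add, QuotientAddGroup.mk_add]

theorem add_tmul (r r' : R) (m : M) : tmul M (r + r') m = tmul M r m + tmul M r' m := by
  simp only [tmul, TensorProduct.add_tmul, QuotientAddGroup.mk_add]

theorem mul_tmul (r s : R) (m : M) : tmul M (r * s) m = tmul M r (incl s • m) := by
  refine QuotientAddGroup.eq.2 ?_
  rw [neg_add_eq_sub, ← neg_sub]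
  exact neg_mem (AddSubgroup.subset_closure ⟨r, s, m, rfl⟩)

/-- The additive map out of `R ⊗_R M` given by a balanced biadditive map. -/
noncomputable def tensorLift {A : Type*} [AddCommGroup A] (b : R →+ M →+ A)
    (hb : ∀ r s m, b (r * s) m = b r (incl s • m)) : RTensor R M →+ A :=
  QuotientAddGroup.lift (tensorRel R M)
    (TensorProduct.liftAddHom b fun n r m ↦ by simp)
    ((AddSubgroup.closure_le _).2 (by
      rintro x ⟨r, s, m, rfl⟩
      simp [hb]))

theorem tensor_induction {p : RTensor R M → Prop} (tmul : ∀ r m, p (tmul M r m))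
    (add : ∀ x y, p x → p y → p (x + y)) (x : RTensor R M) : p x := by
  obtain ⟨x, rfl⟩ := QuotientAddGroup.mk_surjective x
  induction x with
  | zero =>
    have := tmul 0 0
    rwa [NonunitalMod.tmul, TensorProduct.zero_tmul] at this
  | tmul r m => exact tmul r m
  | add x y hx hy => exact add _ _ hx hy

theorem tensor_hom_ext {A : Type*} [AddCommGroup A] {f g : RTensor R M →+ A}
    (h : ∀ r m, f (tmul M r m) = g (tmul M r m)) (x : RTensor R M) : f x = g x :=
  tensor_induction (p := fun x ↦ f x = g x) h (fun x y hx hy ↦ by rw [map_add, map_add, hx, hy]) x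

variable (M) in
/-- The biadditive map `(r, m) ↦ r ⊗ m`. -/
def tmulHom : R →+ M →+ RTensor R M :=
  AddMonoidHom.mk' (fun r ↦ AddMonoidHom.mk' (tmul M r) (tmul_add r))
    fun r r' ↦ AddMonoidHom.ext fun m ↦ add_tmul r r' m

variable (M) in
/-- The left multiplication by `x` on `R ⊗_R M`, through the first factor. -/
noncomputable def tensorSMul (x : Unitalization R) : RTensor R M →+ RTensor R M :=
  tensorLift ((tmulHom M).comp (DistribSMul.toAddMonoidHom R x)) fun r s m ↦ by
    change tmul M (x • (r * s)) m = tmul M (x • r) (incl s • m)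
    rw [← mul_tmul]
    congr 1
    exact incl_injective (by simp only [incl_smul, incl_mul, mul_assoc])

noncomputable instance instModuleTensor : Module (Unitalization R) (RTensor R M) where
  smul x := tensorSMul M x
  one_smul := tensor_hom_ext (f := tensorSMul M 1) (g := .id _) fun r m ↦
    congrArg (tmul M · m) (one_smul _ r)
  mul_smul x y := tensor_hom_ext (f := tensorSMul M (x * y))
    (g := (tensorSMul M x).comp (tensorSMul M y)) fun r m ↦ congrArg (tmul M · m) (mul_smul x y r)
  smul_zero x := map_zero (tensorSMul M x)
  smul_add x := map_add (tensorSMul M x)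
  add_smul x y := tensor_hom_ext (f := tensorSMul M (x + y))
    (g := tensorSMul M x + tensorSMul M y) fun r m ↦
      (congrArg (tmul M · m) (add_smul x y r)).trans (add_tmul _ _ _)
  zero_smul := tensor_hom_ext (f := tensorSMul M 0) (g := 0) fun r m ↦
      (congrArg (tmul M · m) (zero_smul _ r)).trans (DFunLike.congr_fun (map_zero (tmulHom M)) m)

theorem smul_tmul (x : Unitalization R) (r : R) (m : M) : x • tmul M r m = tmul M (x • r) m := rfl

theorem incl_smul_tmul (s r : R) (m : M) : incl s • tmul M r m = tmul M s (incl r • m) := by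
  rw [smul_tmul, incl_smul_self, mul_tmul]

variable (R M) in
/-- The natural map `R ⊗_R M → M` as a map of modules. -/
noncomputable def mulMapLinear : RTensor R M →ₗ[Unitalization R] M :=
  linearMapOfIncl (mulMap R M) fun s ↦ tensor_hom_ext
    (f := (mulMap R M).comp (DistribSMul.toAddMonoidHom _ (incl s)))
    (g := (DistribSMul.toAddMonoidHom _ (incl s)).comp (mulMap R M)) fun r m ↦ by
      change mulMap R M (incl s • tmul M r m) = incl s • mulMap R M (tmul M r m)
      rw [incl_smul_tmul]
      rfl

theorem mulMapLinear_tmul (r : R) (m : M) : mulMapLinear R M (tmul M r m) = incl r • m := rfl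

theorem tensor_linear_ext {f g : RTensor R M →ₗ[Unitalization R] N}
    (h : ∀ r m, f (tmul M r m) = g (tmul M r m)) : f = g :=
  LinearMap.ext (tensor_hom_ext (f := f.toAddMonoidHom) (g := g.toAddMonoidHom) h)

/-- The functoriality of `R ⊗_R -`. -/
noncomputable def tensorMap (f : M →ₗ[Unitalization R] N) :
    RTensor R M →ₗ[Unitalization R] RTensor R N :=
  let F : RTensor R M →+ RTensor R N :=
    tensorLift (AddMonoidHom.mk' (fun r ↦ (tmulHom N r).comp f.toAddMonoidHom)
      fun r r' ↦ AddMonoidHom.ext fun m ↦ add_tmul r r' (f m)) fun r s m ↦ by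
        change tmul N (r * s) (f m) = tmul N r (f (incl s • m))
        rw [mul_tmul, map_smul]
  linearMapOfIncl F fun s ↦ tensor_hom_ext
    (f := F.comp (DistribSMul.toAddMonoidHom _ (incl s)))
    (g := (DistribSMul.toAddMonoidHom _ (incl s)).comp F) fun _ _ ↦ rfl

theorem tensorMap_tmul (f : M →ₗ[Unitalization R] N) (r : R) (m : M) :
    tensorMap f (tmul M r m) = tmul N r (f m) := rfl

end Tensor

end Modules

/-! ### Universal properties of `Hom_R(R, -)` and `R ⊗_R -` -/

section Bijections

variable {R : Type u} [NonUnitalRing R] {M N : Type u} [AddCommGroup M]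
  [Module (Unitalization R) M] [AddCommGroup N] [Module (Unitalization R) N]

/-- Surjectivity says that the products `r m` generate `M` additively. -/
theorem linear_ext_of_surjective (hM : Function.Surjective (mulMap R M))
    {f g : M →ₗ[Unitalization R] N} (h : ∀ (r : R) m, f (incl r • m) = g (incl r • m)) :
    f = g := by
  have : f ∘ₗ mulMapLinear R M = g ∘ₗ mulMapLinear R M := tensor_linear_ext h
  refine LinearMap.ext fun m ↦ ?_
  obtain ⟨x, rfl⟩ := hM m
  exact LinearMap.congr_fun this x

/-- For a t-unital module `M`, maps `M → Hom_R(R, N)` correspond to maps `M → N`. -/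
theorem bijective_homMapLinear_comp (hM : IsTUnital R M) :
    Function.Bijective fun f : M →ₗ[Unitalization R] N ↦ homMapLinear R N ∘ₗ f := by
  refine ⟨fun f g h ↦ linear_ext_of_surjective hM.2 fun r m ↦ ?_, fun g ↦ ?_⟩
  · rw [map_smul, map_smul]
    exact LinearMap.congr_fun (LinearMap.congr_fun h m) r
  -- The preimage `f` of `g` must satisfy `f (s m) = g m s`; this is well defined because `M` is
  -- identified with `R ⊗_R M`.
  · let b : R →+ M →+ N := AddMonoidHom.mk'
      (fun s ↦ AddMonoidHom.mk' (fun m ↦ g m s) fun m m' ↦ by rw [map_add]; rfl)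
      fun s s' ↦ AddMonoidHom.ext fun m ↦ map_add (g m) s s'
    let G := tensorLift b fun r s m ↦ by
      change g m (r * s) = g (incl s • m) r
      rw [map_smul, incl_smul_hom_apply]
    let E := AddEquiv.ofBijective (mulMap R M) hM
    have hE (s : R) (m : M) : E.symm (incl s • m) = tmul M s m :=
      E.symm_apply_eq.2 (mulMap_tmul s m).symm
    have hG (s : R) (m : M) : (G.comp E.symm.toAddMonoidHom) (incl s • m) = g m s :=
      congrArg G (hE s m)
    let f : M →ₗ[Unitalization R] N := linearMapOfIncl (G.comp E.symm.toAddMonoidHom) fun r m ↦ by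
      obtain ⟨x, rfl⟩ := hM.2 m
      induction x using tensor_induction with
      | tmul s m =>
        rw [mulMap_tmul, ← mul_smul, ← incl_mul, hG, hG, ← incl_smul_self, map_smul]
      | add x y hx hy =>
        rw [map_add, smul_add, map_add, map_add, hx, hy, smul_add]
    refine ⟨f, LinearMap.ext fun m ↦ LinearMap.ext fun s ↦ ?_⟩
    change incl s • f m = g m s
    rw [← map_smul]
    exact hG s m

/-- For a c-unital module `N`, maps `R ⊗_R M → N` correspond to maps `M → N`. -/
theorem bijective_comp_mulMapLinear (hN : IsCUnital R N) :
    Function.Bijective fun f : M →ₗ[Unitalization R] N ↦ f ∘ₗ mulMapLinear R M := by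
  refine ⟨fun f g h ↦ LinearMap.ext fun m ↦ hN.1 (LinearMap.ext fun r ↦ ?_), fun g ↦ ?_⟩
  · rw [homMap_apply, homMap_apply, ← map_smul, ← map_smul]
    exact LinearMap.congr_fun h (tmul M r m)
  · let E := LinearEquiv.ofBijective (homMapLinear R N) hN
    -- The preimage of `g` sends `m` to the unique `n` with `r n = g (r ⊗ m)` for all `r`.
    let G (m : M) : R →ₗ[Unitalization R] N :=
      { toFun := fun r ↦ g (tmul M r m)
        map_add' := fun r r' ↦ by rw [add_tmul, map_add]
        map_smul' := fun x r ↦ by rw [← smul_tmul, map_smul, RingHom.id_apply] }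
    let G' : M →ₗ[Unitalization R] (R →ₗ[Unitalization R] N) := linearMapOfIncl
      (AddMonoidHom.mk' G fun m m' ↦ LinearMap.ext fun r ↦ by
        change g (tmul M r (m + m')) = g (tmul M r m) + g (tmul M r m')
        rw [tmul_add, map_add])
      fun s m ↦ LinearMap.ext fun r ↦ by
        rw [incl_smul_hom_apply]
        change g (tmul M r (incl s • m)) = g (tmul M (r * s) m)
        rw [mul_tmul]
    refine ⟨E.symm.toLinearMap ∘ₗ G', tensor_linear_ext fun r m ↦ ?_⟩
    change E.symm (G' (incl r • m)) = g (tmul M r m)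
    rw [map_smul, map_smul]
    exact LinearMap.congr_fun (E.apply_symm_apply (G' m)) r

/-- For a c-unital module `N`, maps `Hom_R(R, M) → N` correspond to maps `M → N`. -/
theorem bijective_linearMap_comp_homMapLinear (hN : IsCUnital R N) :
    Function.Bijective fun f : (R →ₗ[Unitalization R] M) →ₗ[Unitalization R] N ↦
      f ∘ₗ homMapLinear R M := by
  let E := LinearEquiv.ofBijective (homMapLinear R N) hN
  refine ⟨fun f g h ↦ LinearMap.ext fun φ ↦ hN.1 (LinearMap.ext fun r ↦ ?_), fun f ↦
    ⟨E.symm.toLinearMap ∘ₗ homPostcomp f, LinearMap.ext fun m ↦ ?_⟩⟩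
  -- `R` carries `Hom_R(R, M)` into the image of `M`, and no nonzero element of `N` is killed by
  -- `R`.
  · have : incl r • φ = homMapLinear R M (φ r) := LinearMap.ext fun s ↦ by
      rw [incl_smul_hom_apply, homMapLinear_apply, ← map_smul, incl_smul_self]
    rw [homMap_apply, homMap_apply, ← map_smul, ← map_smul, this]
    exact LinearMap.congr_fun h (φ r)
  · refine E.symm_apply_eq.2 (LinearMap.ext fun r ↦ ?_)
    exact map_smul f _ _

/-- For a t-unital module `M`, maps `M → R ⊗_R N` correspond to maps `M → N`. -/
theorem bijective_mulMapLinear_comp (hM : IsTUnital R M) :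
    Function.Bijective fun f : M →ₗ[Unitalization R] RTensor R N ↦ mulMapLinear R N ∘ₗ f := by
  let E := LinearEquiv.ofBijective (mulMapLinear R M) hM
  refine ⟨fun f g h ↦ linear_ext_of_surjective hM.2 fun r m ↦ ?_, fun f ↦
    ⟨tensorMap f ∘ₗ E.symm.toLinearMap, linear_ext_of_surjective hM.2 fun r m ↦ ?_⟩⟩
  -- The action of `r` on `R ⊗_R N` factors through `N`, so a map out of `M = RM` is determined by
  -- its composite to `N`.
  · have key (x : RTensor R N) : incl r • x = tmul N r (mulMapLinear R N x) := by
      induction x using tensor_induction with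
      | tmul s m =>
        rw [incl_smul_tmul, mulMapLinear_tmul]
      | add x y hx hy =>
        rw [smul_add, hx, hy, map_add, tmul_add]
    rw [map_smul, map_smul, key, key]
    exact congrArg (tmul N r) (LinearMap.congr_fun h m)
  · have : E.symm (incl r • m) = tmul M r m := E.symm_apply_eq.2 rfl
    change mulMapLinear R N (tensorMap f (E.symm (incl r • m))) = _
    rw [this, tensorMap_tmul, mulMapLinear_tmul, map_smul]

variable (M) in
-- The natural map of `Hom_R(R, M)` is composition with `M → Hom_R(R, M)`, which is bijective on
-- maps out of the t-unital module `R`.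
theorem isCUnital_hom (hR : IsTUnitalRing R) : IsCUnital R (R →ₗ[Unitalization R] M) := by
  have h := bijective_homMapLinear_comp (N := M) hR
  have : ⇑(homMap R (R →ₗ[Unitalization R] M)) =
      fun f : R →ₗ[Unitalization R] M ↦ homMapLinear R M ∘ₗ f := by
    refine funext fun f ↦ LinearMap.ext fun r ↦ LinearMap.ext fun s ↦ ?_
    change (incl r • f) s = incl s • f r
    rw [incl_smul_hom_apply, ← map_smul, incl_smul_self]
  rw [IsCUnital, this]
  exact h

variable (M) in
-- This is associativity, `R ⊗ (R ⊗ M) ≅ (R ⊗ R) ⊗ M ≅ R ⊗ M`, made explicit: the inverse `B` sends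
-- `rs ⊗ m` to `r ⊗ (s ⊗ m)`.
theorem isTUnital_tensor (hR : IsTUnitalRing R) : IsTUnital R (RTensor R M) := by
  let E := AddEquiv.ofBijective (mulMap R R) hR
  have hE (r s : R) : E.symm (r * s) = tmul R r s :=
    E.symm_apply_eq.2 (incl_smul_self R r s).symm
  let F (m : M) : RTensor R R →+ RTensor R (RTensor R M) :=
    tensorLift (AddMonoidHom.mk' (fun r ↦ (tmulHom _ r).comp ((tmulHom M).flip m))
      fun r r' ↦ AddMonoidHom.ext fun s ↦ add_tmul r r' _) fun r s t ↦ by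
        change tmul _ (r * s) (tmul M t m) = tmul _ r (tmul M (incl s • t) m)
        rw [mul_tmul, smul_tmul]
  have hF (m : M) (r s : R) : F m (tmul R r s) = tmul _ r (tmul M s m) := rfl
  let b : R →+ M →+ RTensor R (RTensor R M) := AddMonoidHom.mk'
    (fun r ↦ AddMonoidHom.mk' (fun m ↦ F m (E.symm r)) fun m m' ↦
      tensor_hom_ext (f := F (m + m')) (g := F m + F m') (fun r s ↦ by
        rw [AddMonoidHom.add_apply, hF, hF, hF, tmul_add, tmul_add]) _)
    fun r r' ↦ AddMonoidHom.ext fun m ↦ by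
      change F m (E.symm (r + r')) = F m (E.symm r) + F m (E.symm r')
      rw [map_add, map_add]
  have hb (r s : R) (m : M) : b (r * s) m = tmul _ r (tmul M s m) := by
    change F m (E.symm (r * s)) = _
    rw [hE, hF]
  have hb' (r s : R) (m : M) : b (r * s) m = b r (incl s • m) := by
    -- Products generate `R` additively, so it suffices to treat `r = p q`, where `b` is known by
    -- `hb`.
    obtain ⟨x, rfl⟩ := hR.2 r
    induction x using tensor_induction with
    | tmul p q =>
      rw [mulMap_tmul, incl_smul_self, mul_assoc, hb, hb, mul_tmul]
    | add x y hx hy =>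
      rw [map_add, add_mul, map_add, map_add, AddMonoidHom.add_apply, AddMonoidHom.add_apply,
        hx, hy]
  let B := tensorLift b hb'
  have hB (x) : B (mulMap R (RTensor R M) x) = x := by
    induction x using tensor_induction with
    | tmul r y =>
      induction y using tensor_induction with
      | tmul s m =>
        rw [mulMap_tmul, smul_tmul, incl_smul_self]
        exact hb r s m
      | add x y hx hy => rw [tmul_add, map_add, map_add, hx, hy]
    | add x y hx hy =>
      rw [map_add, map_add, hx, hy]
  refine ⟨Function.LeftInverse.injective hB, fun x ↦ ?_⟩
  induction x using tensor_induction with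
  | tmul r m =>
    obtain ⟨x, rfl⟩ := hR.2 r
    induction x using tensor_induction with
    | tmul r s =>
      exact ⟨tmul _ r (tmul M s m), rfl⟩
    | add x y hx hy =>
      obtain ⟨x', hx⟩ := hx
      obtain ⟨y', hy⟩ := hy
      exact ⟨x' + y', by rw [map_add, map_add, add_tmul, hx, hy]⟩
  | add x y hx hy =>
    obtain ⟨x', rfl⟩ := hx
    obtain ⟨y', rfl⟩ := hy
    exact ⟨x' + y', map_add _ _ _⟩

end Bijections

/-! ### The reflection and the coreflection -/

section Adjunctions

variable {R : Type u} [NonUnitalRing R]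

/-- The c-unital module `Hom_R(R, M)`. -/
abbrev homObj (hR : IsTUnitalRing R) (M : NMod R) : CMod R :=
  ⟨ModuleCat.of _ (R →ₗ[Unitalization R] M), isCUnital_hom M hR⟩

/-- The t-unital module `R ⊗_R M`. -/
noncomputable abbrev tensorObj (hR : IsTUnitalRing R) (M : NMod R) : TMod R :=
  ⟨ModuleCat.of _ (RTensor R M), isTUnital_tensor M hR⟩

theorem bijective_homObj (hR : IsTUnitalRing R) (M : NMod R) (P : CMod R) :
    Function.Bijective fun f : homObj hR M ⟶ P ↦ ModuleCat.ofHom (homMapLinear R M) ≫ f.hom := by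
  have h := bijective_linearMap_comp_homMapLinear (M := M) P.property
  exact (((ModuleCat.homEquiv.symm.bijective.comp h).comp
    ModuleCat.homEquiv.bijective).comp InducedCategory.homEquiv.bijective)

theorem bijective_tensorObj (hR : IsTUnitalRing R) (P : TMod R) (M : NMod R) :
    Function.Bijective fun f : P ⟶ tensorObj hR M ↦
      f.hom ≫ ModuleCat.ofHom (mulMapLinear R M) := by
  have h := bijective_mulMapLinear_comp (N := M) P.property
  exact (((ModuleCat.homEquiv.symm.bijective.comp h).comp
    ModuleCat.homEquiv.bijective).comp InducedCategory.homEquiv.bijective)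

/-- The universal property of the reflection of a module onto the c-unital modules. -/
noncomputable def homObjEquiv (hR : IsTUnitalRing R) (M : NMod R) (P : CMod R) :
    (homObj hR M ⟶ P) ≃ (M ⟶ P.obj) :=
  Equiv.ofBijective _ (bijective_homObj hR M P)

/-- The universal property of the coreflection of a module onto the t-unital modules. -/
noncomputable def tensorObjEquiv (hR : IsTUnitalRing R) (P : TMod R) (M : NMod R) :
    (P.obj ⟶ M) ≃ (P ⟶ tensorObj hR M) :=
  (Equiv.ofBijective _ (bijective_tensorObj hR P M)).symm

/-- The reflector `Hom_R(R, -)` onto the c-unital modules. -/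
noncomputable def homReflector (hR : IsTUnitalRing R) : NMod R ⥤ CMod R :=
  Adjunction.leftAdjointOfEquiv (G := ObjectProperty.ι (fun P : NMod R ↦ IsCUnital R P))
    (homObjEquiv hR) fun _ _ _ _ _ ↦ rfl

/-- The adjunction exhibiting the c-unital modules as a reflective subcategory. -/
noncomputable def homAdjunction (hR : IsTUnitalRing R) :
    homReflector hR ⊣ ObjectProperty.ι (fun P : NMod R ↦ IsCUnital R P) :=
  Adjunction.adjunctionOfEquivLeft (G := ObjectProperty.ι (fun P : NMod R ↦ IsCUnital R P))
    (homObjEquiv hR) fun _ _ _ _ _ ↦ rfl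

theorem tensorObjEquiv_naturality (hR : IsTUnitalRing R) (P' P : TMod R) (M : NMod R)
    (f : P' ⟶ P) (g : P.obj ⟶ M) :
    tensorObjEquiv hR P' M (f.hom ≫ g) = f ≫ tensorObjEquiv hR P M g := by
  obtain ⟨g, rfl⟩ := (tensorObjEquiv hR P M).symm.surjective g
  rw [Equiv.apply_symm_apply, ← Equiv.eq_symm_apply]
  rfl

/-- The coreflector `R ⊗_R -` onto the t-unital modules. -/
noncomputable def tensorCoreflector (hR : IsTUnitalRing R) : NMod R ⥤ TMod R :=
  Adjunction.rightAdjointOfEquiv (F := ObjectProperty.ι (fun P : NMod R ↦ IsTUnital R P))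
    (tensorObjEquiv hR) (tensorObjEquiv_naturality hR)

/-- The adjunction exhibiting the t-unital modules as a coreflective subcategory. -/
noncomputable def tensorAdjunction (hR : IsTUnitalRing R) :
    ObjectProperty.ι (fun P : NMod R ↦ IsTUnital R P) ⊣ tensorCoreflector hR :=
  Adjunction.adjunctionOfEquivRight (F := ObjectProperty.ι (fun P : NMod R ↦ IsTUnital R P))
    (tensorObjEquiv hR) (tensorObjEquiv_naturality hR)

theorem homAdjunction_unit_app (hR : IsTUnitalRing R) (M : NMod R) :
    (homAdjunction hR).unit.app M = ModuleCat.ofHom (homMapLinear R M) := by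
  simp [homAdjunction]
  rfl

theorem tensorAdjunction_counit_app (hR : IsTUnitalRing R) (M : NMod R) :
    (tensorAdjunction hR).counit.app M = ModuleCat.ofHom (mulMapLinear R M) := by
  simp [tensorAdjunction]
  rfl

end Adjunctions

/-! ### The two equivalences -/

theorem isCProjective_iff_projective {R : Type u} [NonUnitalRing R] (hR : IsTUnitalRing R)
    {Q : NMod R} (hQ : IsTUnital R Q) : IsCProjective Q ↔ Projective Q := by
  have := (homAdjunction hR).left_adjoint_additive
  rw [← preservesCokernels_preadditiveCoyoneda_iff]
  refine preservesCokernels_comp_iff_of_isIso_map_unit (homAdjunction hR) _ fun M ↦ ?_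
  rw [ConcreteCategory.isIso_iff_bijective, homAdjunction_unit_app]
  exact (ModuleCat.homEquiv.symm.bijective.comp (bijective_homMapLinear_comp hQ)).comp
    ModuleCat.homEquiv.bijective

theorem isTInjective_iff_injective {R : Type u} [NonUnitalRing R] (hR : IsTUnitalRing R)
    {J : NMod R} (hJ : IsCUnital R J) : IsTInjective J ↔ Injective J := by
  have := (tensorAdjunction hR).right_adjoint_additive
  rw [← preservesCokernels_preadditiveYoneda_iff]
  -- The opposite of the coreflection is a reflection of `(NMod R)ᵒᵖ` onto `(TMod R)ᵒᵖ`, whose unit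
  -- is the opposite of `R ⊗_R M → M`.
  refine Iff.trans ?_
    (preservesCokernels_comp_iff_of_isIso_map_unit (tensorAdjunction hR).op _ fun M ↦ ?_)
  · exact ⟨fun h X Y f ↦ h f.unop, fun h X Y f ↦ h f.op⟩
  rw [ConcreteCategory.isIso_iff_bijective, Adjunction.op_unit, NatTrans.op_app,
    tensorAdjunction_counit_app]
  have h := bijective_comp_mulMapLinear (M := M.unop) hJ
  have e := (ModuleCat.homEquiv (M := ModuleCat.of _ (RTensor R M.unop)) (N := J)).symm.bijective
  exact (e.comp h).comp ModuleCat.homEquiv.bijective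

end NonunitalMod

theorem corollary8p6 (R : Type u) [NonUnitalRing R] (hR : NonunitalMod.IsTUnitalRing R) :
    (∀ Q : NonunitalMod.NMod R, NonunitalMod.IsTUnital R Q →
      (NonunitalMod.IsCProjective Q ↔ Projective Q)) ∧
    (∀ J : NonunitalMod.NMod R, NonunitalMod.IsCUnital R J →
      (NonunitalMod.IsTInjective J ↔ Injective J)) :=
  ⟨fun _ hQ ↦ NonunitalMod.isCProjective_iff_projective hR hQ,
    fun _ hJ ↦ NonunitalMod.isTInjective_iff_injective hR hJ⟩
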